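/- Let $X$ and $Y$ be metric spaces and let $\overline{X}=X\,\dot\cup\,\{\Diamond\}$, where $\Diamond$ stands for "undefined". A (local) semiflow on a metric space $Z$ is a map $\pi$ assigning to $(t,z)\in\mathbb{R}^+\times Z$ a value $z\pi t\in Z\cup\{\Diamond\}$ such that $\{(t,z): z\pi t\neq\Diamond\}$ is open in $\mathbb{R}^+\times Z$, $\pi$ is continuous on this set, $z\pi 0=z$ and $z\pi(s+t)=(z\pi s)\pi t$ (with $\Diamond\pi t=\Diamond$). Here $\mathbb{R}^+=[0,\infty)$. Let $(t,y)\mapsto y^t$ be a global semiflow on $Y$ and $\Phi:\mathbb{R}^+\times Y\times X\to\overline{X}$ such that $(y,x)\pi t:=(y^t,\Phi(t,y,x))$ (and $:=\Diamond$ if $\Phi(t,y,x)=\Diamond$) is a semiflow on $Y\times X$. Fix $y_0\in Y$. Let $\mathcal{H}^+(y_0)=\overline{\{y_0^t:t\ge 0\}}$, let $\omega(y_0)=\bigcap_{s\ge0}\overline{\{y_0^t:t\ge s\}}$, let $r(t,x)=(y_0^t,x)$, and let $\chi$ be the semiflow on $\mathbb{R}^+\times X$ given by $(t_0,x)\chi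 t=(t_0+t,\Phi(t,y_0^{t_0},x))$ (and $\Diamond$ if undefined). Statements such as $z\pi t\in A$ or $z\pi[0,t]\subset A$ include that the points concerned are defined; in particular $\Diamond\notin A$ for every set $A$ of points. For $N\subset Y\times X$ let $\mathrm{Inv}(N)$ be the set of all $u(0)$, where $u:\mathbb{R}\to N$ satisfies $u(t_1)=u(t_0)\pi(t_1-t_0)$ for all $t_0\le t_1$. A set $K$ is invariant if $\mathrm{Inv}(K)=K$. A closed set $N\subset\mathcal{H}^+(y_0)\times X$ is an isolating neighbourhood of $K$ in $\mathcal{H}^+(y_0)\times X$ if $K$ lies in the interior of $N$ relative to $\mathcal{H}^+(y_0)\times X$ and $K=\mathrm{Inv}(N)$. "Strongly admissible", for a set $M\subset Y\times X$, is understood in one of the following two senses, the same one throughout. (A) Whenever $z_n\in M$, $t_n\in\mathbb{R}^+$ and $z_n\pi[0,t_n]\subset M$ for all $n$, the sequence $z_n\pi t_n$ has a convergent subsequence. (B) (Rybakowski) There are no $z$ and $t$ with $z\pi[0,t)\subset M$ and $z\pi t=\Diamond$; and whenever $z_n\in M$, $t_n\to\infty$ and $z_n\pi[0,t_n]\subset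 M$ for all $n$, the sequence $z_n\pi t_n$ has a convergent subsequence. Let $K\subset\omega(y_0)\times X$ be invariant. A pair $(N_1,N_2)$ of subsets of $\mathbb{R}^+\times X$ is an index pair for $(y_0,K)$ if (IP1) $N_2\subset N_1$, and both sets are closed in $\mathbb{R}^+\times X$; (IP2) if $x\in N_1$ and $x\chi t\notin N_1$, then $x\chi s\in N_2$ for some $s\in[0,t]$; (IP3) if $x\in N_2$ and $x\chi t\notin N_2$, then $x\chi s\in(\mathbb{R}^+\times X)\setminus N_1$ for some $s\in[0,t]$; (IP4) there is a strongly admissible isolating neighbourhood $N$ of $K$ in $\mathcal{H}^+(y_0)\times X$ with $N_1\setminus N_2\subset r^{-1}(N)$; (IP5) there is a neighbourhood $W$ of $K$ in $\mathcal{H}^+(y_0)\times X$ with $r^{-1}(W)\subset N_1\setminus N_2$. An index pair $(N_1,N_2)$ is regular if the inner exit time $T_i:N_1\to[0,\infty]$, $T_i(x)=\sup\{t\in\mathbb{R}^+: x\chi[0,t]\subset N_1\setminus N_2\}$ (with $\sup\emptyset=0$), is continuous. For $T\ge 0$ put $N_2^{-T}=\{x\in N_1:\ x\chi s\in N_2\text{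 for some }s\in[0,T]\}$. **Lemma.** In each of the two senses of strong admissibility: if $(N_1,N_2)$ is an index pair for $(y_0,K)$, then there are a constant $\tau\in\mathbb{R}^+$ and a set $N_2'\subset N_1$ such that $N_2\subset N_2'\subset N_2^{-\tau}$ and $(N_1,N_2')$ is a regular index pair for $(y_0,K)$. -/

import Mathlib

open scoped NNReal ENNReal Topology

/-- A (local) semiflow on `Z`. The value `none` plays the role of the symbol `◇` ("undefined"); it
is absorbing because of the `Option.bind` in `map_add`. -/
structure IsSemiflow {Z : Type*} [TopologicalSpace Z] (π : ℝ≥0 → Z → Option Z) : Prop where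
  isOpen_domain : IsOpen {p : ℝ≥0 × Z | (π p.1 p.2).isSome}
  continuous_on_domain :
    Continuous (fun p : {p : ℝ≥0 × Z | (π p.1 p.2).isSome} => (π p.1.1 p.1.2).get p.2)
  map_zero : ∀ z, π 0 z = some z
  map_add : ∀ s t z, π (s + t) z = (π s z).bind (π t)

/-- `StaysIn π A z t`: the value `z π t` is defined and belongs to `A`. -/
def StaysIn {Z : Type*} (π : ℝ≥0 → Z → Option Z) (A : Set Z) (z : Z) (t : ℝ≥0) : Prop :=
  ∃ w ∈ A, π t z = some w

/-- A full solution `u : ℝ → Z` of the semiflow `π`. -/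
def IsFullSolution {Z : Type*} (π : ℝ≥0 → Z → Option Z) (u : ℝ → Z) : Prop :=
  ∀ t₀ t₁ : ℝ, t₀ ≤ t₁ → π (Real.toNNReal (t₁ - t₀)) (u t₀) = some (u t₁)

/-- The largest invariant subset of `N`: the points of `N` through which there is a full solution
in `N`. -/
def invariantPart {Z : Type*} (π : ℝ≥0 → Z → Option Z) (N : Set Z) : Set Z :=
  {z | ∃ u : ℝ → Z, IsFullSolution π u ∧ (∀ t, u t ∈ N) ∧ u 0 = z}

/-- The set `K` is invariant. -/
def IsInvariantSet {Z : Type*} (π : ℝ≥0 → Z → Option Z) (K : Set Z) : Prop :=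
  invariantPart π K = K

/-- The semiflow `π` explodes in `M`. -/
def ExplodesIn {Z : Type*} (π : ℝ≥0 → Z → Option Z) (M : Set Z) : Prop :=
  ∃ (z : Z) (t : ℝ≥0), (∀ s < t, StaysIn π M z s) ∧ π t z = none

/-- Strong admissibility, without any restriction on the times `t n`. -/
def StronglyAdmissible {Z : Type*} [TopologicalSpace Z] (π : ℝ≥0 → Z → Option Z)
    (M : Set Z) : Prop :=
  ∀ (z w : ℕ → Z) (t : ℕ → ℝ≥0), (∀ n, ∀ s ≤ t n, StaysIn π M (z n) s) →
    (∀ n, π (t n) (z n) = some (w n)) →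
    ∃ (p : Z) (φ : ℕ → ℕ), StrictMono φ ∧ Filter.Tendsto (w ∘ φ) Filter.atTop (𝓝 p)

/-- Strong admissibility in the sense of Rybakowski: `π` does not explode in `M`, and the
compactness condition is only required for sequences of times tending to infinity. -/
def AsymptoticallyStronglyAdmissible {Z : Type*} [TopologicalSpace Z] (π : ℝ≥0 → Z → Option Z)
    (M : Set Z) : Prop :=
  ¬ ExplodesIn π M ∧
  ∀ (z w : ℕ → Z) (t : ℕ → ℝ≥0), Filter.Tendsto t Filter.atTop Filter.atTop →
    (∀ n, ∀ s ≤ t n, StaysIn π M (z n) s) → (∀ n, π (t n) (z n) = some (w n)) →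
    ∃ (p : Z) (φ : ℕ → ℕ), StrictMono φ ∧ Filter.Tendsto (w ∘ φ) Filter.atTop (𝓝 p)

/-- `W` is a neighbourhood of `K` in the subspace `A`. -/
def IsNeighbourhoodIn {Z : Type*} [TopologicalSpace Z] (A W K : Set Z) : Prop :=
  W ⊆ A ∧ K ⊆ A ∧ ∀ z ∈ K, W ∈ 𝓝[A] z

/-- A skew-product semiflow `(.^t, Φ)` on `Y × X`: a global semiflow `shift` on `Y` and a map
`Φ` such that `(y, x) π t = (y^t, Φ(t, y, x))` is a semiflow. -/
structure SkewProductSemiflow (Y X : Type*) [TopologicalSpace Y] [TopologicalSpace X] where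
  shift : Flow ℝ≥0 Y
  Φ : ℝ≥0 → Y → X → Option X
  isSemiflow : IsSemiflow
    (fun (t : ℝ≥0) (z : Y × X) => (Φ t z.1 z.2).map (fun x => (shift t z.1, x)))

namespace SkewProductSemiflow

variable {Y X : Type*} [TopologicalSpace Y] [TopologicalSpace X] (S : SkewProductSemiflow Y X)

/-- The semiflow `π` on `Y × X`. -/
def semiflow (t : ℝ≥0) (z : Y × X) : Option (Y × X) :=
  (S.Φ t z.1 z.2).map (fun x => (S.shift t z.1, x))

/-- The evolution operator `Φ_y(t, t₀, x) = Φ(t - t₀, y^{t₀}, x)`, meant for `t₀ ≤ t`. -/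
def evolution (y : Y) (t t₀ : ℝ≥0) (x : X) : Option X :=
  S.Φ (t - t₀) (S.shift t₀ y) x

/-- The semiflow `χ_y` on the extended phase space `ℝ⁺ × X`:
`(t₀, x) χ_y t = (t₀ + t, Φ_y(t₀ + t, t₀, x))`. -/
def extendedSemiflow (y : Y) (t : ℝ≥0) (p : ℝ≥0 × X) : Option (ℝ≥0 × X) :=
  (S.evolution y (p.1 + t) p.1 p.2).map (fun x => (p.1 + t, x))

/-- The positive hull `H⁺(y)`. -/
def positiveHull (y : Y) : Set Y :=
  closure (Set.range fun t : ℝ≥0 => S.shift t y)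

/-- The `ω`-limit set of `y`. -/
def omegaSet (y : Y) : Set Y :=
  omegaLimit Filter.atTop (fun (t : ℝ≥0) (y' : Y) => S.shift t y') {y}

/-- `N` is an isolating neighbourhood for `(y₀, K)` in `H⁺(y₀) × X`. -/
structure IsIsolatingNeighbourhood (y₀ : Y) (K N : Set (Y × X)) : Prop where
  isClosed : IsClosed N
  isNeighbourhood : IsNeighbourhoodIn (S.positiveHull y₀ ×ˢ Set.univ) N K
  largest_invariant : invariantPart S.semiflow N = K

/-- The map `r_{y₀}(t, x) = (y₀^t, x)`. -/
def toHull (y₀ : Y) (p : ℝ≥0 × X) : Y × X :=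
  (S.shift p.1 y₀, p.2)

end SkewProductSemiflow

/-- `(N₁, N₂)` is a basic index pair relative to the semiflow `χ`, i.e. (IP1)-(IP3). -/
structure IsBasicIndexPair {Z : Type*} [TopologicalSpace Z] (χ : ℝ≥0 → Z → Option Z)
    (N₁ N₂ : Set Z) : Prop where
  subset : N₂ ⊆ N₁
  isClosed_left : IsClosed N₁
  isClosed_right : IsClosed N₂
  exit_through : ∀ x ∈ N₁, ∀ t, ¬ StaysIn χ N₁ x t → ∃ s ≤ t, StaysIn χ N₂ x s
  exit_set : ∀ x ∈ N₂, ∀ t, ¬ StaysIn χ N₂ x t → ∃ s ≤ t, StaysIn χ N₁ᶜ x s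

/-- The set `N₂^{-T}(N₁)`. -/
def backwardExtension {Z : Type*} (χ : ℝ≥0 → Z → Option Z) (N₁ N₂ : Set Z) (T : ℝ≥0) : Set Z :=
  {x ∈ N₁ | ∃ s ≤ T, StaysIn χ N₂ x s}

/-- The inner exit time `sup {t : x χ [0, t] ⊆ N₁ \ N₂}` in `[0, ∞]` (`sup ∅ = 0`). -/
noncomputable def innerExitTime {Z : Type*} (χ : ℝ≥0 → Z → Option Z) (N₁ N₂ : Set Z) (x : Z) :
    ℝ≥0∞ :=
  sSup {T : ℝ≥0∞ | ∃ t : ℝ≥0, T = t ∧ ∀ s ≤ t, StaysIn χ (N₁ \ N₂) x s}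

namespace SkewProductSemiflow

variable {Y X : Type*} [TopologicalSpace Y] [TopologicalSpace X] (S : SkewProductSemiflow Y X)

/-- `(N₁, N₂)` is an index pair for `(y₀, K)`. The parameter `Adm` is the notion of strong
admissibility that the isolating neighbourhood has to satisfy. -/
structure IsIndexPair (Adm : Set (Y × X) → Prop) (y₀ : Y) (K : Set (Y × X))
    (N₁ N₂ : Set (ℝ≥0 × X)) : Prop where
  basic : IsBasicIndexPair (S.extendedSemiflow y₀) N₁ N₂
  subset_omega : K ⊆ S.omegaSet y₀ ×ˢ Set.univ
  invariant : IsInvariantSet S.semiflow K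
  exists_isolating : ∃ N : Set (Y × X), Adm N ∧ S.IsIsolatingNeighbourhood y₀ K N ∧
    N₁ \ N₂ ⊆ S.toHull y₀ ⁻¹' N
  exists_neighbourhood : ∃ W : Set (Y × X),
    IsNeighbourhoodIn (S.positiveHull y₀ ×ˢ Set.univ) W K ∧ S.toHull y₀ ⁻¹' W ⊆ N₁ \ N₂

/-- A regular index pair for `(y₀, K)`: the inner exit time `N₁ → [0, ∞]` is continuous. -/
structure IsRegularIndexPair (Adm : Set (Y × X) → Prop) (y₀ : Y) (K : Set (Y × X))
    (N₁ N₂ : Set (ℝ≥0 × X)) : Prop where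
  isIndexPair : S.IsIndexPair Adm y₀ K N₁ N₂
  continuousOn_exitTime : ContinuousOn (innerExitTime (S.extendedSemiflow y₀) N₁ N₂) N₁

end SkewProductSemiflow

/-! Choose a continuous `φ ≥ 0` on `ℝ⁺ × X` vanishing exactly on `N₂` and at least `1` on `r⁻¹(V)`,
with `V` an open neighbourhood of `K`. Let `F(x)` be the integral of `φ` along the orbit of `x` over
`[0, B]`, stopped on leaving `N₁ \ N₂`, and put `N₂' = {F ≤ 1/2}`; any threshold strictly between
`0` and `1` would do.

`F` is continuous on `N₁` although the exit time need not be: orbits leave through `N₂`, where `φ`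
is zero (`continuous_cutoff`). By admissibility, an orbit spending a long time in `N` is inside `V`
in the middle of that time (`exists_middlePoints_subset`). Hence, for a suitable `B`, staying in `N₁
\ N₂` up to time `B` forces `F ≥ 1`, so points of `N₂'` reach `N₂` by time `B`. Until then `F`
strictly decreases (`exitIntegral_lt_of_mem_regularExitSet`). This gives (IP3) for `N₂'`, and it
makes the inner exit time continuous, because orbits cross the level `1/2` instead of merely
touching it. -/

/-! ### Local semiflows and orbit segments. -/

section Semiflow

variable {Z : Type*} {π : ℝ≥0 → Z → Option Z}

/-- The orbit segment `z π [0, t]` is defined and contained in `A`. -/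
def StaysOn (π : ℝ≥0 → Z → Option Z) (A : Set Z) (z : Z) (t : ℝ≥0) : Prop :=
  ∀ s ≤ t, StaysIn π A z s

theorem StaysIn.mono {A B : Set Z} (h : A ⊆ B) {z : Z} {t : ℝ≥0} (hz : StaysIn π A z t) :
    StaysIn π B z t := by
  obtain ⟨w, hw, e⟩ := hz
  exact ⟨w, h hw, e⟩

theorem StaysOn.mono {A B : Set Z} (h : A ⊆ B) {z : Z} {t : ℝ≥0} (hz : StaysOn π A z t) :
    StaysOn π B z t :=
  fun s hs => (hz s hs).mono h

theorem StaysOn.of_le {A : Set Z} {z : Z} {s t : ℝ≥0} (hz : StaysOn π A z t) (h : s ≤ t) :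
    StaysOn π A z s :=
  fun s' hs => hz s' (hs.trans h)

theorem staysIn_iff_of_eq {A : Set Z} {z w : Z} {t : ℝ≥0} (h : π t z = some w) :
    StaysIn π A z t ↔ w ∈ A := by
  simp [StaysIn, h]

variable [TopologicalSpace Z]

namespace IsSemiflow

/-- Combines openness of the domain with continuity on it, so that later arguments avoid the
subtype; `of_eventually_staysIn` is the converse. -/
theorem eventually_staysIn (hπ : IsSemiflow π) {t : ℝ≥0} {z w : Z} (h : π t z = some w)
    {U : Set Z} (hU : U ∈ 𝓝 w) : ∀ᶠ p : ℝ≥0 × Z in 𝓝 (t, z), StaysIn π U p.2 p.1 := by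
  have hd : (t, z) ∈ {p : ℝ≥0 × Z | (π p.1 p.2).isSome} := by simp [h]
  have hc := hπ.continuous_on_domain.continuousAt (x := ⟨(t, z), hd⟩)
  have hU' : U ∈ 𝓝 ((π t z).get hd) := by simpa [h] using hU
  have := hc.preimage_mem_nhds hU'
  rw [nhds_subtype_eq_comap, Filter.mem_comap] at this
  obtain ⟨O, hO, hsub⟩ := this
  filter_upwards [hO, hπ.isOpen_domain.mem_nhds hd] with p hp hpd
  exact ⟨_, hsub (show (⟨p, hpd⟩ : {p : ℝ≥0 × Z | (π p.1 p.2).isSome}) ∈ _ from hp), by simp⟩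

theorem of_eventually_staysIn
    (h : ∀ t z w, π t z = some w → ∀ U ∈ 𝓝 w, ∀ᶠ p : ℝ≥0 × Z in 𝓝 (t, z), StaysIn π U p.2 p.1)
    (h₀ : ∀ z, π 0 z = some z) (h₁ : ∀ s t z, π (s + t) z = (π s z).bind (π t)) :
    IsSemiflow π where
  isOpen_domain := by
    rw [isOpen_iff_mem_nhds]
    rintro ⟨t, z⟩ hp
    obtain ⟨w, hw⟩ := Option.isSome_iff_exists.1 hp
    filter_upwards [h t z w hw Set.univ Filter.univ_mem] with p ⟨w', _, hp⟩
    simp [hp]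
  continuous_on_domain := by
    rw [continuous_iff_continuousAt]
    rintro ⟨⟨t, z⟩, hp⟩ U hU
    have := (continuous_subtype_val.tendsto (⟨(t, z), hp⟩ :
      {p : ℝ≥0 × Z | (π p.1 p.2).isSome})).eventually
        (h t z _ (Option.some_get hp).symm U hU)
    refine this.mono fun q ⟨w, hw, e⟩ => ?_
    simpa [e] using hw
  map_zero := h₀
  map_add := h₁

theorem isOpen_staysIn (hπ : IsSemiflow π) {U : Set Z} (hU : IsOpen U) :
    IsOpen {p : ℝ≥0 × Z | StaysIn π U p.2 p.1} := by
  rw [isOpen_iff_mem_nhds]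
  rintro ⟨t, z⟩ ⟨w, hw, e⟩
  exact hπ.eventually_staysIn e (hU.mem_nhds hw)

theorem isOpen_staysOn (hπ : IsSemiflow π) {U : Set Z} (hU : IsOpen U) :
    IsOpen {p : ℝ≥0 × Z | StaysOn π U p.2 p.1} := by
  rw [isOpen_iff_mem_nhds]
  rintro ⟨t, z⟩ h
  obtain ⟨u, v, hu, hv, htu, hzv, huv⟩ := generalized_tube_lemma (isCompact_Icc (a := 0) (b := t))
    (isCompact_singleton (x := z)) (hπ.isOpen_staysIn hU) (by
      rintro ⟨s, z'⟩ ⟨hs, rfl⟩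
      exact h s hs.2)
  -- Nearby end times may exceed `t`, so the tube is needed slightly beyond `[0, t]`.
  obtain ⟨c, hc, hcu⟩ := exists_Ico_subset_of_mem_nhds
    (hu.mem_nhds (htu ⟨zero_le, le_rfl⟩)) ⟨t + 1, by simp⟩
  rw [nhds_prod_eq]
  filter_upwards [Filter.prod_mem_prod (Iio_mem_nhds hc) (hv.mem_nhds (hzv rfl))]
  rintro ⟨s, z'⟩ ⟨hs, hz'⟩ s' hs'
  refine huv (show (s', z') ∈ u ×ˢ v from ⟨?_, hz'⟩)
  rcases le_total s' t with hst | hst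
  · exact htu ⟨zero_le, hst⟩
  · exact hcu ⟨hst, lt_of_le_of_lt hs' hs⟩

theorem staysIn_add (hπ : IsSemiflow π) {A : Set Z} {s t : ℝ≥0} {z w : Z} (h : π s z = some w) :
    StaysIn π A z (s + t) ↔ StaysIn π A w t := by
  simp [StaysIn, hπ.map_add, h]

theorem staysOn_add (hπ : IsSemiflow π) {A : Set Z} {s t : ℝ≥0} {z w : Z} (h : π s z = some w) :
    StaysOn π A z (s + t) ↔ StaysOn π A z s ∧ StaysOn π A w t := by
  refine ⟨fun H => ⟨H.of_le le_self_add, fun r hr => ?_⟩, fun H r hr => ?_⟩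
  · exact (hπ.staysIn_add h).1 (H _ (by gcongr))
  · rcases le_total r s with hrs | hrs
    · exact H.1 r hrs
    · obtain ⟨q, rfl⟩ := exists_add_of_le hrs
      exact (hπ.staysIn_add h).2 (H.2 q (by simpa using hr))

theorem tendsto_of_eq (hπ : IsSemiflow π) {ι : Type*} {l : Filter ι} {t : ℝ≥0} {z w : Z}
    (h : π t z = some w) {a b : ι → Z} (ha : Filter.Tendsto a l (𝓝 z))
    (hab : ∀ i, π t (a i) = some (b i)) : Filter.Tendsto b l (𝓝 w) := by
  intro U hU
  have := (Filter.Tendsto.prodMk_nhds (tendsto_const_nhds (x := t)) ha).eventually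
    (hπ.eventually_staysIn h hU)
  exact this.mono fun i hi => (staysIn_iff_of_eq (hab i)).1 hi

end IsSemiflow

end Semiflow

/-! ### Admissibility and the largest invariant set. -/

section Admissible

variable {Z : Type*} {π : ℝ≥0 → Z → Option Z} {N : Set Z}

/-- The points `z π T` with `z π [0, 2 T] ⊆ N`. -/
def middlePoints (π : ℝ≥0 → Z → Option Z) (N : Set Z) (T : ℝ≥0) : Set Z :=
  {w | ∃ z, StaysOn π N z (T + T) ∧ π T z = some w}

theorem middlePoints_subset (T : ℝ≥0) : middlePoints π N T ⊆ N := by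
  rintro w ⟨z, hz, e⟩
  exact (staysIn_iff_of_eq e).1 (hz T le_self_add)

variable [TopologicalSpace Z]

/-- Along times increasing to an explosion time the orbit would accumulate at some `p`; but near `p`
the semiflow is defined for a uniform short time, which carries the orbit past the explosion.
Bounded times are essential here. -/
theorem StronglyAdmissible.not_explodesIn (hπ : IsSemiflow π) (h : StronglyAdmissible π N) :
    ¬ ExplodesIn π N := by
  rintro ⟨z, t, ht, e⟩
  have ht₀ : 0 < t := by
    rw [pos_iff_ne_zero]
    rintro rfl
    simp [hπ.map_zero] at e
  obtain ⟨u, -, hu, hut⟩ := exists_seq_strictMono_tendsto' ht₀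
  have hw : ∀ n, ∃ w, π (u n) z = some w := fun n => by
    obtain ⟨w, _, ew⟩ := ht (u n) (hu n).2
    exact ⟨w, ew⟩
  choose w hw using hw
  obtain ⟨p, φ, hφ, hp⟩ := h (fun _ => z) w u
    (fun n s hs => ht s (hs.trans_lt (hu n).2)) hw
  have h₀ := hπ.eventually_staysIn (hπ.map_zero p) Filter.univ_mem
  have h₁ : Filter.Tendsto (fun n => (t - u (φ n), w (φ n))) Filter.atTop (𝓝 (0, p)) := by
    refine Filter.Tendsto.prodMk_nhds ?_ hp
    have := (tendsto_const_nhds (x := t)).sub (hut.comp hφ.tendsto_atTop)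
    simpa using this
  obtain ⟨n, q, -, hq⟩ := (h₁.eventually h₀).exists
  have := hπ.map_add (u (φ n)) (t - u (φ n)) z
  rw [add_tsub_cancel_of_le (hu _).2.le, e, hw, Option.bind_some] at this
  simp only at hq
  rw [hq] at this
  simp at this

theorem StronglyAdmissible.asymptoticallyStronglyAdmissible (hπ : IsSemiflow π)
    (h : StronglyAdmissible π N) : AsymptoticallyStronglyAdmissible π N :=
  ⟨h.not_explodesIn hπ, fun z w t _ => h z w t⟩

/-- The limits of points whose orbits stay in `N` for long times in both directions. -/
def limitPoints (π : ℝ≥0 → Z → Option Z) (N : Set Z) : Set Z :=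
  ⋂ T, closure (middlePoints π N T)

theorem eq_some_of_add (hπ : IsSemiflow π) {s t : ℝ≥0} {z w v : Z} (h : π s z = some w)
    (h' : π (s + t) z = some v) : π t w = some v := by
  rwa [hπ.map_add, h, Option.bind_some] at h'

theorem antitone_middlePoints (hπ : IsSemiflow π) : Antitone (middlePoints π N) := by
  rintro S T hST w ⟨z, hz, e⟩
  obtain ⟨r, rfl⟩ := exists_add_of_le hST
  obtain ⟨v, hv, ev⟩ := hz r (by rw [add_assoc, add_left_comm]; exact le_self_add)
  refine ⟨v, ?_, eq_some_of_add hπ ev (by rwa [add_comm])⟩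
  have : S + r + (S + r) = r + (S + S + r) := by ring
  rw [this] at hz
  exact ((hπ.staysOn_add ev).1 hz).2.of_le le_self_add

theorem limitPoints_subset (hN : IsClosed N) : limitPoints π N ⊆ N :=
  (Set.iInter_subset _ 0).trans (closure_minimal (middlePoints_subset 0) hN)

theorem invariantPart_subset_limitPoints : invariantPart π N ⊆ limitPoints π N := by
  rintro _ ⟨u, hu, hN, rfl⟩
  refine Set.mem_iInter.2 fun T => subset_closure ⟨u (-T), fun s _ => ⟨u (-T + s), hN _, ?_⟩, ?_⟩
  · simpa using hu (-T) (-T + s) (by simp)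
  · simpa using hu (-T) 0 (by simp)

/-- `limitPoints` is positively invariant. -/
theorem mem_limitPoints_of_eq (hπ : IsSemiflow π) {p q : Z} {t : ℝ≥0}
    (hp : p ∈ limitPoints π N) (e : π t p = some q) : q ∈ limitPoints π N := by
  refine Set.mem_iInter.2 fun T => mem_closure_iff_nhds.2 fun U hU => ?_
  have := (Continuous.tendsto (f := fun z : Z => (t, z)) (by fun_prop) p).eventually
    (hπ.eventually_staysIn e hU)
  -- Reserving `T + t` on each side of `w` leaves `T` on each side of `v = w π t`, when the starting
  -- point is moved forward by `2t`.
  obtain ⟨w, ⟨v, hv, ev⟩, z, hz, ez⟩ :=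
    mem_closure_iff_nhds.1 (Set.mem_iInter.1 hp (T + t)) _ this
  have hsum : T + t + (T + t) = t + t + (T + T) := by ring
  rw [hsum] at hz
  obtain ⟨a, ha, ea⟩ := hz (t + t) le_self_add
  refine ⟨v, hv, a, ((hπ.staysOn_add ea).1 hz).2, eq_some_of_add hπ ea ?_⟩
  have : t + t + T = T + t + t := by ring
  rw [this, hπ.map_add, ez, Option.bind_some]
  exact ev

/-- Otherwise there is a first undefined time, the set of undefined times being closed; before it
the orbit lies in `N`, so it explodes in `N`. -/
theorem exists_eq_some_of_mem_limitPoints (hπ : IsSemiflow π) (hN : IsClosed N)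
    (hex : ¬ ExplodesIn π N) {p : Z} (hp : p ∈ limitPoints π N) (t : ℝ≥0) :
    ∃ q ∈ limitPoints π N, π t p = some q := by
  suffices ∃ q, π t p = some q by
    obtain ⟨q, e⟩ := this
    exact ⟨q, mem_limitPoints_of_eq hπ hp e, e⟩
  by_contra hc
  set A : Set ℝ≥0 := {s | π s p = none} with hA
  have hAc : IsClosed A := by
    have : A = {s : ℝ≥0 | StaysIn π Set.univ p s}ᶜ := by
      ext s
      simp [hA, StaysIn, Option.eq_none_iff_forall_ne_some]
    rw [this, isClosed_compl_iff]
    exact (hπ.isOpen_staysIn isOpen_univ).preimage (by fun_prop : Continuous fun s : ℝ≥0 => (s, p))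
  have hne : A.Nonempty := ⟨t, by
    rw [hA, Set.mem_ofPred_eq, Option.eq_none_iff_forall_ne_some]
    exact fun q hq => hc ⟨q, hq⟩⟩
  refine hex ⟨p, sInf A, fun s hs => ?_, hAc.csInf_mem hne (OrderBot.bddBelow A)⟩
  have : s ∉ A := notMem_of_lt_csInf hs (OrderBot.bddBelow A)
  obtain ⟨q, hq⟩ := Option.ne_none_iff_exists'.1 this
  exact ⟨q, limitPoints_subset hN (mem_limitPoints_of_eq hπ hp hq), hq⟩

/-- Sequences of points whose orbits stay in `N` for longer and longer times in both directions
accumulate in `limitPoints`. -/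
theorem exists_subseq_tendsto_limitPoints (hπ : IsSemiflow π)
    (h : AsymptoticallyStronglyAdmissible π N) {w : ℕ → Z}
    (hw : ∀ n : ℕ, w n ∈ middlePoints π N n) :
    ∃ p ∈ limitPoints π N, ∃ φ : ℕ → ℕ, StrictMono φ ∧
      Filter.Tendsto (w ∘ φ) Filter.atTop (𝓝 p) := by
  choose z hz e using hw
  obtain ⟨p, φ, hφ, hp⟩ := h.2 z w (fun n => n) tendsto_natCast_atTop_atTop
    (fun n => (hz n).of_le le_self_add) e
  refine ⟨p, Set.mem_iInter.2 fun T => ?_, φ, hφ, hp⟩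
  refine mem_closure_of_tendsto hp ?_
  obtain ⟨n₀, hn₀⟩ := exists_nat_ge T
  filter_upwards [Filter.eventually_ge_atTop n₀] with n hn
  refine antitone_middlePoints hπ (hn₀.trans ?_) ⟨_, hz (φ n), e (φ n)⟩
  exact_mod_cast hn.trans hφ.le_apply

end Admissible

section Metric

variable {Z : Type*} [MetricSpace Z] {π : ℝ≥0 → Z → Option Z} {N : Set Z}

/-- Middle points approximating `p` have predecessors which are again middle points for long times;
by admissibility these accumulate at some `q`, and continuity of the time-one map gives `q π 1 = p`.
-/
theorem exists_predecessor_of_mem_limitPoints (hπ : IsSemiflow π) (hN : IsClosed N)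
    (h : AsymptoticallyStronglyAdmissible π N) {p : Z} (hp : p ∈ limitPoints π N) :
    ∃ q ∈ limitPoints π N, π 1 q = some p := by
  have hw : ∀ n : ℕ, ∃ w ∈ middlePoints π N (n + 1), dist w p < 1 / (n + 1) := fun n => by
    obtain ⟨w, hw, hd⟩ := Metric.mem_closure_iff.1 (Set.mem_iInter.1 hp (n + 1)) (1 / (n + 1))
      Nat.one_div_pos_of_nat
    exact ⟨w, hw, by rwa [dist_comm]⟩
  choose w hw hd using hw
  have hwp : Filter.Tendsto w Filter.atTop (𝓝 p) := by
    rw [tendsto_iff_dist_tendsto_zero]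
    exact squeeze_zero (fun _ => dist_nonneg) (fun n => (hd n).le)
      tendsto_one_div_add_atTop_nhds_zero_nat
  have hv : ∀ n : ℕ, ∃ v ∈ middlePoints π N n, π 1 v = some (w n) := fun n => by
    obtain ⟨z, hz, e⟩ := hw n
    obtain ⟨v, -, ev⟩ := hz n (by rw [add_assoc]; exact le_self_add)
    exact ⟨v, ⟨z, hz.of_le (by gcongr <;> exact le_self_add), ev⟩, eq_some_of_add hπ ev e⟩
  choose v hv ev using hv
  obtain ⟨q, hq, φ, hφ, hvq⟩ := exists_subseq_tendsto_limitPoints hπ h hv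
  refine ⟨q, hq, ?_⟩
  obtain ⟨p', -, e⟩ := exists_eq_some_of_mem_limitPoints hπ hN h.1 hq 1
  rw [e, tendsto_nhds_unique (hwp.comp hφ.tendsto_atTop)
    (hπ.tendsto_of_eq e hvq fun n => ev (φ n))]

/-- A set in which every point has an image for all times and a predecessor at time `1` consists of
points on full solutions. -/
theorem subset_invariantPart_of_exists (hπ : IsSemiflow π) {E : Set Z} (hE : E ⊆ N)
    (hfwd : ∀ p ∈ E, ∀ t, ∃ q ∈ E, π t p = some q) (hback : ∀ p ∈ E, ∃ q ∈ E, π 1 q = some p) :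
    E ⊆ invariantPart π N := by
  intro p hp
  choose f hfE hf using hback
  let P : ℕ → E := Nat.rec ⟨p, hp⟩ fun _ q => ⟨f q q.2, hfE q q.2⟩
  have hP : ∀ n, π 1 (P (n + 1)).1 = some (P n).1 := fun n => hf (P n).1 (P n).2
  choose g hgE hg using hfwd
  have hshift : ∀ (t : ℝ≥0) (n k : ℕ), π (t + k) (P (n + k)).1 = π t (P n).1 := fun t n k => by
    induction k with
    | zero => simp
    | succ k ih =>
      have : t + ((k + 1 : ℕ) : ℝ≥0) = 1 + (t + k) := by push_cast; ring
      rw [this, hπ.map_add, ← add_assoc, hP, Option.bind_some, ih]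
  -- `P n` sits at time `-n`, and `u t` flows forward from the latest such point with `-n ≤ t`; by
  -- `hshift` any earlier one gives the same value.
  let u : ℝ → Z := fun t => g (P ⌈-t⌉₊).1 (P ⌈-t⌉₊).2 (t + ⌈-t⌉₊).toNNReal
  have hu : ∀ (t : ℝ) (n : ℕ), -t ≤ n → π (t + n).toNNReal (P n).1 = some (u t) := fun t n hn => by
    obtain ⟨k, hk⟩ := exists_add_of_le (Nat.ceil_le.2 hn)
    have h₀ : 0 ≤ t + (⌈-t⌉₊ : ℝ) := by linarith [Nat.le_ceil (-t)]
    have h₁ : (t + n).toNNReal = (t + ⌈-t⌉₊).toNNReal + k := by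
      rw [hk, Nat.cast_add, ← add_assoc, Real.toNNReal_add h₀ (Nat.cast_nonneg k),
        Real.toNNReal_natCast]
    rw [h₁, hk, hshift]
    exact hg _ _ _
  refine ⟨u, fun t₀ t₁ ht => ?_, fun t => hE (hgE _ _ _), ?_⟩
  · obtain ⟨n, hn⟩ := exists_nat_ge (-t₀)
    refine eq_some_of_add hπ (hu t₀ n hn) ?_
    rw [← Real.toNNReal_add (by linarith) (by linarith)]
    have : t₀ + n + (t₁ - t₀) = t₁ + n := by ring
    rw [this]
    exact hu t₁ n (by linarith)
  · have := hu 0 0 (by simp)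
    simp only [CharP.cast_eq_zero, add_zero, Real.toNNReal_zero, hπ.map_zero,
      Option.some_inj] at this
    exact this.symm

theorem invariantPart_eq_limitPoints (hπ : IsSemiflow π) (hN : IsClosed N)
    (h : AsymptoticallyStronglyAdmissible π N) : invariantPart π N = limitPoints π N :=
  invariantPart_subset_limitPoints.antisymm
    (subset_invariantPart_of_exists hπ (limitPoints_subset hN)
      (fun _ hp t => exists_eq_some_of_mem_limitPoints hπ hN h.1 hp t)
      fun _ hp => exists_predecessor_of_mem_limitPoints hπ hN h hp)

theorem isClosed_invariantPart (hπ : IsSemiflow π) (hN : IsClosed N)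
    (h : AsymptoticallyStronglyAdmissible π N) : IsClosed (invariantPart π N) := by
  rw [invariantPart_eq_limitPoints hπ hN h]
  exact isClosed_iInter fun _ => isClosed_closure

/-- Middle points outside `O` for ever longer times would accumulate in the invariant part, yet
outside `O`. The resulting `T` determines the constant `τ`. -/
theorem exists_middlePoints_subset (hπ : IsSemiflow π) (hN : IsClosed N)
    (h : AsymptoticallyStronglyAdmissible π N) {O : Set Z} (hO : IsOpen O)
    (hK : invariantPart π N ⊆ O) : ∃ T, middlePoints π N T ⊆ O := by
  by_contra! hc
  have hw : ∀ n : ℕ, ∃ w ∈ middlePoints π N n, w ∉ O := fun n => Set.not_subset.1 (hc n)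
  choose w hw hwO using hw
  obtain ⟨p, hp, φ, -, hφp⟩ := exists_subseq_tendsto_limitPoints hπ h hw
  rw [← invariantPart_eq_limitPoints hπ hN h] at hp
  exact hO.isClosed_compl.mem_of_tendsto hφp (Filter.Eventually.of_forall fun n => hwO (φ n)) (hK hp)

end Metric

/-! ### Orbits relative to a basic index pair. -/

namespace IsBasicIndexPair

variable {Z : Type*} [TopologicalSpace Z] {χ : ℝ≥0 → Z → Option Z} {N₁ N₂ : Set Z}

/-- By (IP2) an orbit leaves `N₁`, or ceases to exist, only after meeting `N₂`. Staying in `N₁ \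
N₂`, which need not be open, thus becomes avoidance of a closed set. -/
theorem staysOn_diff_iff (h : IsBasicIndexPair χ N₁ N₂) {x : Z} (hx : x ∈ N₁) {t : ℝ≥0} :
    StaysOn χ (N₁ \ N₂) x t ↔ ∀ s ≤ t, ¬ StaysIn χ N₂ x s := by
  constructor
  · rintro H s hs ⟨w, hw, e⟩
    exact ((staysIn_iff_of_eq e).1 (H s hs)).2 hw
  · intro H s hs
    by_contra hc
    have : ¬ StaysIn χ N₁ x s := by
      rintro ⟨w, hw, e⟩
      exact hc ⟨w, ⟨hw, fun hw₂ => H s hs ⟨w, hw₂, e⟩⟩, e⟩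
    obtain ⟨r, hr, hr₂⟩ := h.exit_through x hx s this
    exact H r (hr.trans hs) hr₂

theorem exists_staysIn_of_not_staysOn (h : IsBasicIndexPair χ N₁ N₂) {x : Z} (hx : x ∈ N₁)
    {t : ℝ≥0} (ht : ¬ StaysOn χ (N₁ \ N₂) x t) : ∃ s ≤ t, StaysIn χ N₂ x s := by
  simpa [h.staysOn_diff_iff hx] using ht

/-- After its entrance into `N₂`, an orbit either is in `N₂` or has left `N₁`. -/
theorem staysIn_or_exists_compl (hχ : IsSemiflow χ) (h : IsBasicIndexPair χ N₁ N₂) {x : Z}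
    {s t : ℝ≥0} (hst : s ≤ t) (hs : StaysIn χ N₂ x s) :
    StaysIn χ N₂ x t ∨ ∃ r ≤ t, StaysIn χ N₁ᶜ x r := by
  obtain ⟨q, rfl⟩ := exists_add_of_le hst
  obtain ⟨w, hw, e⟩ := hs
  by_cases hq : StaysIn χ N₂ w q
  · exact Or.inl ((hχ.staysIn_add e).2 hq)
  · obtain ⟨r, hr, hr₁⟩ := h.exit_set w hw q hq
    exact Or.inr ⟨s + r, by gcongr, (hχ.staysIn_add e).2 hr₁⟩

theorem eventually_staysOn (hχ : IsSemiflow χ) (h : IsBasicIndexPair χ N₁ N₂) {x : Z} {t : ℝ≥0}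
    (hx : StaysOn χ (N₁ \ N₂) x t) :
    ∀ᶠ p : ℝ≥0 × Z in 𝓝 (t, x), p.2 ∈ N₁ → StaysOn χ (N₁ \ N₂) p.2 p.1 := by
  have := (hχ.isOpen_staysOn h.isClosed_right.isOpen_compl).mem_nhds
    (show (t, x) ∈ {p : ℝ≥0 × Z | StaysOn χ N₂ᶜ p.2 p.1} from hx.mono fun _ hw => hw.2)
  filter_upwards [this] with p hp hp₁
  rw [h.staysOn_diff_iff hp₁]
  rintro s hs ⟨w, hw, e⟩
  exact (staysIn_iff_of_eq e).1 (hp s hs) hw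

end IsBasicIndexPair

/-! ### The integral along orbits up to the exit. -/

open Classical in
/-- The value of `φ` at `x χ s`, as long as `x χ [0, s] ⊆ D`, and `0` afterwards. -/
noncomputable def cutoff {Z : Type*} (χ : ℝ≥0 → Z → Option Z) (D : Set Z) (φ : Z → ℝ) (s : ℝ≥0)
    (x : Z) : ℝ :=
  -- The default `0` of `elim` is never reached, since `StaysOn` includes that `χ s x` is defined.
  if StaysOn χ D x s then (χ s x).elim 0 φ else 0

/-- The integral of `φ` along the part of `x χ [0, B]` before the exit from `D`. -/
noncomputable def exitIntegral {Z : Type*} (χ : ℝ≥0 → Z → Option Z) (D : Set Z) (φ : Z → ℝ)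
    (B : ℝ≥0) (x : Z) : ℝ :=
  ∫ s in (0 : ℝ)..B, cutoff χ D φ s.toNNReal x

section Cutoff

variable {Z : Type*} {χ : ℝ≥0 → Z → Option Z} {D : Set Z} {φ : Z → ℝ}

theorem cutoff_of_not {x : Z} {s : ℝ≥0} (h : ¬ StaysOn χ D x s) : cutoff χ D φ s x = 0 :=
  if_neg h

theorem cutoff_of_eq {x w : Z} {s : ℝ≥0} (h : StaysOn χ D x s) (e : χ s x = some w) :
    cutoff χ D φ s x = φ w := by
  simp [cutoff, h, e]

theorem le_cutoff {x : Z} {s : ℝ≥0} {c : ℝ} (h : StaysOn χ D x s)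
    (hc : ∀ w ∈ D, χ s x = some w → c ≤ φ w) : c ≤ cutoff χ D φ s x := by
  obtain ⟨w, hw, e⟩ := h s le_rfl
  rw [cutoff_of_eq h e]
  exact hc w hw e

theorem cutoff_nonneg (hφ : ∀ z, 0 ≤ φ z) (s : ℝ≥0) (x : Z) : 0 ≤ cutoff χ D φ s x := by
  by_cases h : StaysOn χ D x s
  · exact le_cutoff h fun w _ _ => hφ w
  · rw [cutoff_of_not h]

variable [TopologicalSpace Z] {N₁ N₂ : Set Z}

theorem cutoff_add (hχ : IsSemiflow χ) {x w : Z} {t : ℝ≥0} (h : StaysOn χ D x t)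
    (e : χ t x = some w) (s : ℝ≥0) : cutoff χ D φ s w = cutoff χ D φ (t + s) x := by
  have : StaysOn χ D x (t + s) ↔ StaysOn χ D w s := by simp [hχ.staysOn_add e, h]
  by_cases hs : StaysOn χ D w s
  · simp only [cutoff, if_pos hs, if_pos (this.2 hs), hχ.map_add, e, Option.bind_some]
  · rw [cutoff_of_not hs, cutoff_of_not (mt this.1 hs)]

namespace IsBasicIndexPair

/-- An orbit that has met `N₂` is either still in `N₂`, where `φ` is zero and hence small nearby, or
has been outside the closed set `N₁`; then so have nearby orbits, and their cutoff is zero. -/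
theorem continuous_cutoff (hχ : IsSemiflow χ) (h : IsBasicIndexPair χ N₁ N₂) (hφ : Continuous φ)
    (hφ₀ : ∀ z ∈ N₂, φ z = 0) :
    Continuous fun p : ℝ≥0 × N₁ => cutoff χ (N₁ \ N₂) φ p.1 p.2 := by
  rw [continuous_iff_continuousAt]
  rintro ⟨s, x, hx⟩
  have hval : Filter.Tendsto (fun p : ℝ≥0 × N₁ => (p.1, (p.2 : Z))) (𝓝 (s, ⟨x, hx⟩)) (𝓝 (s, x)) :=
    Continuous.tendsto (f := fun p : ℝ≥0 × N₁ => (p.1, (p.2 : Z))) (by fun_prop) (s, ⟨x, hx⟩)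
  rw [ContinuousAt, Filter.tendsto_def]
  intro U hU
  by_cases hs : StaysOn χ (N₁ \ N₂) x s
  · obtain ⟨w, hw, e⟩ := hs s le_rfl
    rw [cutoff_of_eq hs e] at hU
    filter_upwards [hval.eventually (h.eventually_staysOn hχ hs),
      hval.eventually (hχ.eventually_staysIn e (hφ.continuousAt hU))] with p hp₁ hp₂
    obtain ⟨w', hw', e'⟩ := hp₂
    rw [Set.mem_preimage, cutoff_of_eq (hp₁ p.2.2) e']
    exact hw'
  rw [cutoff_of_not hs] at hU
  have h₀ : (0 : ℝ) ∈ U := mem_of_mem_nhds hU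
  obtain ⟨r, hr, hr₂⟩ := h.exists_staysIn_of_not_staysOn hx hs
  rcases h.staysIn_or_exists_compl hχ hr hr₂ with ⟨w, hw, e⟩ | ⟨q, hq, w, hw, e⟩
  · rw [← hφ₀ w hw] at hU
    filter_upwards [hval.eventually (hχ.eventually_staysIn e (hφ.continuousAt hU))]
      with p ⟨w', hw', e'⟩
    by_cases hp : StaysOn χ (N₁ \ N₂) p.2 p.1
    · rw [Set.mem_preimage, cutoff_of_eq hp e']
      exact hw'
    · rwa [Set.mem_preimage, cutoff_of_not hp]
  -- If `q = s`, nearby times `p.1` may be smaller than `q`; the minimum keeps the time of absence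
  -- within `[0, p.1]`.
  · have hmin : Filter.Tendsto (fun p : ℝ≥0 × N₁ => (min q p.1, (p.2 : Z))) (𝓝 (s, ⟨x, hx⟩))
        (𝓝 (q, x)) := by
      have := Continuous.tendsto (f := fun p : ℝ≥0 × N₁ => (min q p.1, (p.2 : Z))) (by fun_prop)
        (s, ⟨x, hx⟩)
      simpa [hq] using this
    filter_upwards [hmin.eventually
      (hχ.eventually_staysIn e (h.isClosed_left.isOpen_compl.mem_nhds hw))] with p ⟨w', hw', e'⟩
    have hp : ¬ StaysOn χ (N₁ \ N₂) p.2 p.1 := fun hp =>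
      hw' ((staysIn_iff_of_eq e').1 (hp _ (min_le_right _ _))).1
    rwa [Set.mem_preimage, cutoff_of_not hp]

theorem continuous_cutoff_toNNReal (hχ : IsSemiflow χ) (h : IsBasicIndexPair χ N₁ N₂)
    (hφ : Continuous φ) (hφ₀ : ∀ z ∈ N₂, φ z = 0) {x : Z} (hx : x ∈ N₁) :
    Continuous fun s : ℝ => cutoff χ (N₁ \ N₂) φ s.toNNReal x :=
  (h.continuous_cutoff hχ hφ hφ₀).comp
    (continuous_real_toNNReal.prodMk (continuous_const (y := (⟨x, hx⟩ : N₁))))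

theorem continuousOn_exitIntegral (hχ : IsSemiflow χ) (h : IsBasicIndexPair χ N₁ N₂)
    (hφ : Continuous φ) (hφ₀ : ∀ z ∈ N₂, φ z = 0) (B : ℝ≥0) :
    ContinuousOn (exitIntegral χ (N₁ \ N₂) φ B) N₁ := by
  rw [continuousOn_iff_continuous_domRestrict]
  refine intervalIntegral.continuous_parametric_intervalIntegral_of_continuous'
    (f := fun (x : N₁) (s : ℝ) => cutoff χ (N₁ \ N₂) φ s.toNNReal x) ?_ 0 B
  exact (h.continuous_cutoff hχ hφ hφ₀).comp
    ((continuous_real_toNNReal.comp continuous_snd).prodMk continuous_fst)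

theorem exitIntegral_eq_zero (hχ : IsSemiflow χ) (B : ℝ≥0) {x : Z}
    (hx : x ∈ N₂) : exitIntegral χ (N₁ \ N₂) φ B x = 0 := by
  have : ∀ s : ℝ, cutoff χ (N₁ \ N₂) φ s.toNNReal x = 0 := fun s => by
    refine cutoff_of_not fun hs => ?_
    exact ((staysIn_iff_of_eq (hχ.map_zero x)).1 (hs 0 zero_le)).2 hx
  simp [exitIntegral, this]

/-- The integral over `[0, B]` decreases along an orbit by the integral over the time elapsed,
provided that the orbit exits before `B`. -/
theorem exitIntegral_add (hχ : IsSemiflow χ) (h : IsBasicIndexPair χ N₁ N₂)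
    (hφ : Continuous φ) (hφ₀ : ∀ z ∈ N₂, φ z = 0) {B : ℝ≥0} {x w : Z} (hx : x ∈ N₁)
    (hB : ¬ StaysOn χ (N₁ \ N₂) x B) {t : ℝ≥0} (ht : StaysOn χ (N₁ \ N₂) x t)
    (e : χ t x = some w) :
    exitIntegral χ (N₁ \ N₂) φ t x + exitIntegral χ (N₁ \ N₂) φ B w =
      exitIntegral χ (N₁ \ N₂) φ B x := by
  have hc := h.continuous_cutoff_toNNReal hχ hφ hφ₀ hx
  have hi : ∀ a b : ℝ, IntervalIntegrable
      (fun s : ℝ => cutoff χ (N₁ \ N₂) φ s.toNNReal x) MeasureTheory.volume a b :=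
    fun a b => hc.intervalIntegrable a b
  have h₁ : exitIntegral χ (N₁ \ N₂) φ B w =
      ∫ s in (t : ℝ)..(t + B : ℝ), cutoff χ (N₁ \ N₂) φ s.toNNReal x := by
    have : exitIntegral χ (N₁ \ N₂) φ B w =
        ∫ s in (0 : ℝ)..B, cutoff χ (N₁ \ N₂) φ (t + s).toNNReal x := by
      refine intervalIntegral.integral_congr fun s hs => ?_
      rw [Set.uIcc_of_le B.coe_nonneg] at hs
      rw [cutoff_add hχ ht e, Real.toNNReal_add t.coe_nonneg hs.1, Real.toNNReal_coe]
    rw [this, intervalIntegral.integral_comp_add_left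
      (fun s : ℝ => cutoff χ (N₁ \ N₂) φ s.toNNReal x)]
    simp
  -- The orbit has exited by time `B`, so truncating at `B` rather than at `t + B` loses nothing.
  have h₂ : ∫ s in (B : ℝ)..(t + B : ℝ), cutoff χ (N₁ \ N₂) φ s.toNNReal x = 0 := by
    have : ∫ s in (B : ℝ)..(t + B : ℝ), cutoff χ (N₁ \ N₂) φ s.toNNReal x =
        ∫ s in (B : ℝ)..(t + B : ℝ), (0 : ℝ) := by
      refine intervalIntegral.integral_congr fun s hs => ?_
      rw [Set.uIcc_of_le (by simp)] at hs
      exact cutoff_of_not fun hc => hB (hc.of_le (NNReal.le_toNNReal_of_coe_le hs.1))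
    simpa using this
  rw [h₁, exitIntegral, exitIntegral, intervalIntegral.integral_add_adjacent_intervals (hi _ _)
    (hi _ _), ← intervalIntegral.integral_add_adjacent_intervals (hi 0 B) (hi B _), h₂, add_zero]

theorem exitIntegral_pos (hχ : IsSemiflow χ) (h : IsBasicIndexPair χ N₁ N₂)
    (hφ : Continuous φ) (hφ₀ : ∀ z ∈ N₂, φ z = 0) (hφ₁ : ∀ z ∉ N₂, 0 < φ z) {x : Z} (hx : x ∈ N₁)
    {t : ℝ≥0} (ht₀ : 0 < t) (ht : StaysOn χ (N₁ \ N₂) x t) :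
    0 < exitIntegral χ (N₁ \ N₂) φ t x := by
  refine intervalIntegral.intervalIntegral_pos_of_pos_on
    ((h.continuous_cutoff_toNNReal hχ hφ hφ₀ hx).intervalIntegrable _ _) (fun s hs => ?_)
    (by exact_mod_cast ht₀)
  have hs' := ht.of_le (Real.toNNReal_le_iff_le_coe.2 hs.2.le)
  obtain ⟨w, hw, e⟩ := hs' _ le_rfl
  rw [cutoff_of_eq hs' e]
  exact hφ₁ w hw.2

/-- A lower bound for the integral over an interval of length one. -/
theorem one_le_exitIntegral (hχ : IsSemiflow χ) (h : IsBasicIndexPair χ N₁ N₂)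
    (hφ : Continuous φ) (hφ₀ : ∀ z ∈ N₂, φ z = 0) (hφ_nonneg : ∀ z, 0 ≤ φ z) {x : Z}
    (hx : x ∈ N₁) {a B : ℝ≥0} (hB : a + 1 ≤ B)
    (ha : ∀ s, a ≤ s → s ≤ a + 1 → 1 ≤ cutoff χ (N₁ \ N₂) φ s x) :
    1 ≤ exitIntegral χ (N₁ \ N₂) φ B x := by
  have hi : ∀ a b : ℝ, IntervalIntegrable
      (fun s : ℝ => cutoff χ (N₁ \ N₂) φ s.toNNReal x) MeasureTheory.volume a b :=
    fun a b => (h.continuous_cutoff_toNNReal hχ hφ hφ₀ hx).intervalIntegrable a b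
  have hB' : (a : ℝ) + 1 ≤ B := by exact_mod_cast hB
  calc (1 : ℝ) = ∫ s in (a : ℝ)..(a + 1 : ℝ), (1 : ℝ) := by simp
    _ ≤ ∫ s in (a : ℝ)..(a + 1 : ℝ), cutoff χ (N₁ \ N₂) φ s.toNNReal x := by
      refine intervalIntegral.integral_mono_on (by simp) (by simp) (hi _ _) fun s hs => ?_
      refine ha _ (NNReal.le_toNNReal_of_coe_le hs.1) (Real.toNNReal_le_iff_le_coe.2 ?_)
      simpa using hs.2
    _ ≤ exitIntegral χ (N₁ \ N₂) φ B x := by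
      refine intervalIntegral.integral_mono_interval a.coe_nonneg (by simp) hB'
        (Filter.Eventually.of_forall fun s => cutoff_nonneg hφ_nonneg _ _) (hi _ _)

end IsBasicIndexPair

end Cutoff

/-! ### The regularised exit set. -/

/-- The points of `N₁` at which the exit integral is at most `1 / 2`. -/
def regularExitSet {Z : Type*} (χ : ℝ≥0 → Z → Option Z) (N₁ N₂ : Set Z) (φ : Z → ℝ) (B : ℝ≥0) :
    Set Z :=
  {x ∈ N₁ | exitIntegral χ (N₁ \ N₂) φ B x ≤ 1 / 2}

namespace IsBasicIndexPair

variable {Z : Type*} {χ : ℝ≥0 → Z → Option Z} {N₁ N₂ : Set Z} {φ : Z → ℝ} {B : ℝ≥0}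

theorem not_staysOn_of_mem_regularExitSet
    (hB : ∀ x ∈ N₁, StaysOn χ (N₁ \ N₂) x B → 1 ≤ exitIntegral χ (N₁ \ N₂) φ B x) {x : Z}
    (hx : x ∈ regularExitSet χ N₁ N₂ φ B) : ¬ StaysOn χ (N₁ \ N₂) x B := fun hs => by
  have := hB x hx.1 hs
  have := hx.2
  linarith

theorem le_innerExitTime {D₁ D₂ : Set Z} {x : Z} {t : ℝ≥0} (h : StaysOn χ (D₁ \ D₂) x t) :
    (t : ℝ≥0∞) ≤ innerExitTime χ D₁ D₂ x :=
  le_sSup ⟨t, rfl, h⟩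

theorem innerExitTime_le {D₁ D₂ : Set Z} {x : Z} {t : ℝ≥0} (h : ¬ StaysOn χ (D₁ \ D₂) x t) :
    innerExitTime χ D₁ D₂ x ≤ t := by
  refine sSup_le ?_
  rintro _ ⟨s, rfl, hs⟩
  by_contra! hc
  exact h (StaysOn.of_le hs (by exact_mod_cast hc.le))

variable [TopologicalSpace Z]

theorem subset_regularExitSet (hχ : IsSemiflow χ) (h : IsBasicIndexPair χ N₁ N₂) :
    N₂ ⊆ regularExitSet χ N₁ N₂ φ B :=
  fun x hx => ⟨h.subset hx, by rw [exitIntegral_eq_zero hχ B hx]; norm_num⟩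

theorem regularExitSet_subset_backwardExtension (h : IsBasicIndexPair χ N₁ N₂)
    (hB : ∀ x ∈ N₁, StaysOn χ (N₁ \ N₂) x B → 1 ≤ exitIntegral χ (N₁ \ N₂) φ B x) :
    regularExitSet χ N₁ N₂ φ B ⊆ backwardExtension χ N₁ N₂ B := fun _ hx =>
  ⟨hx.1, h.exists_staysIn_of_not_staysOn hx.1 (not_staysOn_of_mem_regularExitSet hB hx)⟩

/-- The exit occurs before `B`, so the integral drops by exactly its part over `[0, t]`, which is
positive because `φ > 0` off `N₂`. -/
theorem exitIntegral_lt_of_mem_regularExitSet (hχ : IsSemiflow χ) (h : IsBasicIndexPair χ N₁ N₂)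
    (hφ : Continuous φ) (hφ₀ : ∀ z ∈ N₂, φ z = 0) (hφ₁ : ∀ z ∉ N₂, 0 < φ z)
    (hB : ∀ x ∈ N₁, StaysOn χ (N₁ \ N₂) x B → 1 ≤ exitIntegral χ (N₁ \ N₂) φ B x) {x w : Z}
    (hx : x ∈ regularExitSet χ N₁ N₂ φ B) {t : ℝ≥0} (ht₀ : 0 < t)
    (ht : StaysOn χ (N₁ \ N₂) x t) (e : χ t x = some w) :
    exitIntegral χ (N₁ \ N₂) φ B w < 1 / 2 := by
  have h₁ := h.exitIntegral_add hχ hφ hφ₀ hx.1 (not_staysOn_of_mem_regularExitSet hB hx) ht e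
  have h₂ := h.exitIntegral_pos hχ hφ hφ₀ hφ₁ hx.1 ht₀ ht
  have h₃ := hx.2
  linarith

theorem isBasicIndexPair_regularExitSet (hχ : IsSemiflow χ) (h : IsBasicIndexPair χ N₁ N₂)
    (hφ : Continuous φ) (hφ₀ : ∀ z ∈ N₂, φ z = 0) (hφ₁ : ∀ z ∉ N₂, 0 < φ z)
    (hB : ∀ x ∈ N₁, StaysOn χ (N₁ \ N₂) x B → 1 ≤ exitIntegral χ (N₁ \ N₂) φ B x) :
    IsBasicIndexPair χ N₁ (regularExitSet χ N₁ N₂ φ B) where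
  subset _ hx := hx.1
  isClosed_left := h.isClosed_left
  isClosed_right :=
    (h.continuousOn_exitIntegral hχ hφ hφ₀ B).preimage_isClosed_of_isClosed h.isClosed_left
      isClosed_Iic
  exit_through x hx t ht := by
    obtain ⟨s, hs, hs₂⟩ := h.exit_through x hx t ht
    exact ⟨s, hs, hs₂.mono (h.subset_regularExitSet hχ)⟩
  exit_set x hx t ht := by
    -- While in `N₁ \ N₂` the integral only decreases; after that the orbit is in `N₂` or has left
    -- `N₁`.
    by_cases hs : StaysOn χ (N₁ \ N₂) x t
    · refine absurd ?_ ht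
      obtain ⟨w, hw, e⟩ := hs t le_rfl
      refine ⟨w, ⟨hw.1, ?_⟩, e⟩
      rcases eq_or_ne t 0 with rfl | ht₀
      · rw [hχ.map_zero, Option.some_inj] at e
        exact e ▸ hx.2
      · exact (h.exitIntegral_lt_of_mem_regularExitSet hχ hφ hφ₀ hφ₁ hB hx (pos_iff_ne_zero.2 ht₀)
          hs e).le
    · obtain ⟨s, hst, hs₂⟩ := h.exists_staysIn_of_not_staysOn hx.1 hs
      rcases h.staysIn_or_exists_compl hχ hst hs₂ with h₂ | h₁
      · exact absurd (h₂.mono (h.subset_regularExitSet hχ)) ht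
      · exact h₁

/-- Every orbit entering the set `regularExitSet` crosses its boundary at once. -/
theorem exists_exitIntegral_lt (hχ : IsSemiflow χ) (h : IsBasicIndexPair χ N₁ N₂)
    (hφ : Continuous φ) (hφ₀ : ∀ z ∈ N₂, φ z = 0) (hφ₁ : ∀ z ∉ N₂, 0 < φ z)
    (hB : ∀ x ∈ N₁, StaysOn χ (N₁ \ N₂) x B → 1 ≤ exitIntegral χ (N₁ \ N₂) φ B x) {x : Z}
    (hx : x ∈ N₁) {s t : ℝ≥0} (hst : s < t) (hs : StaysIn χ (regularExitSet χ N₁ N₂ φ B) x s) :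
    ∃ r ≤ t, ∃ w ∈ N₁, χ r x = some w ∧ exitIntegral χ (N₁ \ N₂) φ B w < 1 / 2 := by
  by_cases ht : StaysOn χ (N₁ \ N₂) x t
  · obtain ⟨q, rfl⟩ := exists_add_of_le hst.le
    obtain ⟨v, hv, e⟩ := hs
    have hvq := ((hχ.staysOn_add e).1 ht).2
    obtain ⟨w, hw, e'⟩ := hvq q le_rfl
    refine ⟨_, le_rfl, w, hw.1, by rw [hχ.map_add, e, Option.bind_some, e'], ?_⟩
    exact h.exitIntegral_lt_of_mem_regularExitSet hχ hφ hφ₀ hφ₁ hB hv (by simpa using hst) hvq e'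
  · obtain ⟨r, hr, w, hw, e⟩ := h.exists_staysIn_of_not_staysOn hx ht
    exact ⟨r, hr, w, h.subset hw, e, by rw [exitIntegral_eq_zero hχ B hw]; norm_num⟩

/-- Lower semicontinuity holds for every basic index pair. Upper semicontinuity uses that just after
its entrance the orbit finds a point with integral strictly below `1/2`, an open condition shared by
nearby orbits. -/
theorem continuousOn_innerExitTime (hχ : IsSemiflow χ) (h : IsBasicIndexPair χ N₁ N₂)
    (hφ : Continuous φ) (hφ₀ : ∀ z ∈ N₂, φ z = 0) (hφ₁ : ∀ z ∉ N₂, 0 < φ z)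
    (hB : ∀ x ∈ N₁, StaysOn χ (N₁ \ N₂) x B → 1 ≤ exitIntegral χ (N₁ \ N₂) φ B x) :
    ContinuousOn (innerExitTime χ N₁ (regularExitSet χ N₁ N₂ φ B)) N₁ := by
  have h' := h.isBasicIndexPair_regularExitSet hχ hφ hφ₀ hφ₁ hB
  intro x hx
  refine tendsto_order.2 ⟨fun a ha => ?_, fun b hb => ?_⟩
  · obtain ⟨_, ⟨t, rfl, ht⟩, hat⟩ := lt_sSup_iff.1 ha
    have := (Continuous.tendsto (f := fun z : Z => (t, z)) (by fun_prop) x).eventually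
      (h'.eventually_staysOn hχ ht)
    filter_upwards [nhdsWithin_le_nhds this, self_mem_nhdsWithin] with z hz hz₁
    exact hat.trans_le (le_innerExitTime (hz hz₁))
  · obtain ⟨t, hxt, htb⟩ := ENNReal.lt_iff_exists_nnreal_btwn.1 hb
    -- The entrance happens by time `u`; the gap up to `t` is where the integral becomes strictly
    -- smaller.
    obtain ⟨u, hxu, hut⟩ := ENNReal.lt_iff_exists_nnreal_btwn.1 hxt
    have hu : ¬ StaysOn χ (N₁ \ regularExitSet χ N₁ N₂ φ B) x u := fun hu =>
      hxu.not_ge (le_innerExitTime hu)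
    obtain ⟨s, hsu, hs⟩ := h'.exists_staysIn_of_not_staysOn hx hu
    obtain ⟨r, hr, w, hw, e, hlt⟩ := h.exists_exitIntegral_lt hχ hφ hφ₀ hφ₁ hB hx
      (hsu.trans_lt (by exact_mod_cast hut)) hs
    have hU := (h.continuousOn_exitIntegral hχ hφ hφ₀ B w hw).eventually (Iio_mem_nhds hlt)
    rw [eventually_nhdsWithin_iff] at hU
    have := (Continuous.tendsto (f := fun z : Z => (r, z)) (by fun_prop) x).eventually
      (hχ.eventually_staysIn e hU)
    filter_upwards [nhdsWithin_le_nhds this] with z ⟨v, hv, ez⟩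
    refine (innerExitTime_le (t := r) fun hz => ?_).trans_lt
      (lt_of_le_of_lt (by exact_mod_cast hr) htb)
    have hzv := (staysIn_iff_of_eq ez).1 (hz r le_rfl)
    exact hzv.2 ⟨hzv.1, (hv hzv.1).le⟩

end IsBasicIndexPair

/-! ### The extended semiflow and its projection to the hull. -/

namespace SkewProductSemiflow

variable {Y X : Type*} [TopologicalSpace Y] [TopologicalSpace X] (S : SkewProductSemiflow Y X)

theorem isSemiflow_semiflow : IsSemiflow S.semiflow := S.isSemiflow

theorem continuous_toHull (y : Y) : Continuous (S.toHull y) :=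
  (S.shift.continuous continuous_fst continuous_const).prodMk continuous_snd

theorem semiflow_toHull (y : Y) (t : ℝ≥0) (p : ℝ≥0 × X) :
    S.semiflow t (S.toHull y p) = (S.extendedSemiflow y t p).map (S.toHull y) := by
  simp only [semiflow, toHull, extendedSemiflow, evolution, add_tsub_cancel_left, Option.map_map]
  congr 1
  funext x
  simp only [Function.comp_apply, toHull, add_comm p.1 t]
  rw [S.shift.map_add]

theorem extendedSemiflow_eq (y : Y) (t : ℝ≥0) (p : ℝ≥0 × X) :
    S.extendedSemiflow y t p = (S.semiflow t (S.toHull y p)).map fun z => (p.1 + t, z.2) := by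
  simp only [semiflow, toHull, extendedSemiflow, evolution, add_tsub_cancel_left, Option.map_map]
  rfl

theorem semiflow_toHull_of_eq {y : Y} {t : ℝ≥0} {p q : ℝ≥0 × X}
    (h : S.extendedSemiflow y t p = some q) :
    S.semiflow t (S.toHull y p) = some (S.toHull y q) := by
  rw [semiflow_toHull, h, Option.map_some]

theorem staysIn_toHull_iff {y : Y} {A : Set (Y × X)} {p : ℝ≥0 × X} {t : ℝ≥0} :
    StaysIn S.semiflow A (S.toHull y p) t ↔
      StaysIn (S.extendedSemiflow y) (S.toHull y ⁻¹' A) p t := by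
  simp only [StaysIn, semiflow_toHull, Option.map_eq_some_iff, Set.mem_preimage]
  constructor
  · rintro ⟨_, hw, q, hq, rfl⟩
    exact ⟨q, hw, hq⟩
  · rintro ⟨q, hw, hq⟩
    exact ⟨_, hw, q, hq, rfl⟩

theorem staysOn_toHull_iff {y : Y} {A : Set (Y × X)} {p : ℝ≥0 × X} {t : ℝ≥0} :
    StaysOn S.semiflow A (S.toHull y p) t ↔
      StaysOn (S.extendedSemiflow y) (S.toHull y ⁻¹' A) p t :=
  forall₂_congr fun _ _ => S.staysIn_toHull_iff

/-- `χ` is `π` along `r` together with a clock, so openness and continuity are inherited from `π`.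
-/
theorem isSemiflow_extendedSemiflow (y : Y) : IsSemiflow (S.extendedSemiflow y) := by
  refine IsSemiflow.of_eventually_staysIn (fun t p q h U hU => ?_) (fun p => ?_) fun s t p => ?_
  · have hq : q.1 = p.1 + t := by
      rw [extendedSemiflow, Option.map_eq_some_iff] at h
      obtain ⟨x, -, rfl⟩ := h
      rfl
    obtain ⟨A, hA, B, hB, hAB⟩ := mem_nhds_prod_iff.1 hU
    have h₁ : Filter.Tendsto (fun a : ℝ≥0 × ℝ≥0 × X => a.2.1 + a.1) (𝓝 (t, p)) (𝓝 q.1) := by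
      rw [hq]
      exact Continuous.tendsto (f := fun a : ℝ≥0 × ℝ≥0 × X => a.2.1 + a.1) (by fun_prop) (t, p)
    have h₂ : Filter.Tendsto (fun a : ℝ≥0 × ℝ≥0 × X => (a.1, S.toHull y a.2)) (𝓝 (t, p))
        (𝓝 (t, S.toHull y p)) :=
      (continuous_fst.prodMk ((S.continuous_toHull y).comp continuous_snd)).tendsto (t, p)
    have h₃ : Prod.snd ⁻¹' B ∈ 𝓝 (S.toHull y q) := continuousAt_snd.preimage_mem_nhds hB
    filter_upwards [h₁.eventually hA, h₂.eventually
      (S.isSemiflow_semiflow.eventually_staysIn (S.semiflow_toHull_of_eq h) h₃)]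
      with a ha ⟨w, hw, e⟩
    refine ⟨(a.2.1 + a.1, w.2), hAB ⟨ha, hw⟩, ?_⟩
    rw [extendedSemiflow_eq, show S.semiflow a.1 (S.toHull y a.2) = some w from e, Option.map_some]
  · rw [extendedSemiflow_eq, S.isSemiflow_semiflow.map_zero]
    simp [toHull]
  · rw [extendedSemiflow_eq, S.isSemiflow_semiflow.map_add, semiflow_toHull]
    cases h : S.extendedSemiflow y s p with
    | none => rfl
    | some q =>
      have hq : q.1 = p.1 + s := by
        rw [extendedSemiflow, Option.map_eq_some_iff] at h
        obtain ⟨x, -, rfl⟩ := h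
        rfl
      rw [Option.map_some, Option.bind_some, Option.bind_some, extendedSemiflow_eq, hq, add_assoc]

theorem toHull_mem (y : Y) (p : ℝ≥0 × X) :
    S.toHull y p ∈ S.positiveHull y ×ˢ (Set.univ : Set X) :=
  ⟨subset_closure ⟨p.1, rfl⟩, trivial⟩

end SkewProductSemiflow

/-! ### The weight function and regularisation of index pairs. -/

theorem IsClosed.exists_continuous_eq_zero_iff {Z : Type*} [MetricSpace Z] {C : Set Z}
    (hC : IsClosed C) :
    ∃ f : Z → ℝ, Continuous f ∧ (∀ z, 0 ≤ f z) ∧ ∀ z, f z = 0 ↔ z ∈ C := by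
  rcases C.eq_empty_or_nonempty with rfl | hne
  · exact ⟨fun _ => 1, continuous_const, fun _ => zero_le_one, by simp⟩
  · exact ⟨fun z => Metric.infDist z C, Metric.continuous_infDist_pt C,
      fun _ => Metric.infDist_nonneg, fun z => (hC.mem_iff_infDist_zero hne).symm⟩

/-- A function which vanishes on a closed set `C` only, and is at least `1` on the preimage of a
neighbourhood of the closed set `K`. -/
theorem exists_continuous_one_le {Z E : Type*} [MetricSpace Z] [MetricSpace E] {C : Set Z}
    (hC : IsClosed C) {r : Z → E} (hr : Continuous r) {K O : Set E} (hK : IsClosed K)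
    (hO : IsOpen O) (hKO : K ⊆ O) (hCO : ∀ z ∈ C, r z ∉ O) :
    ∃ (φ : Z → ℝ) (V : Set E), Continuous φ ∧ (∀ z, 0 ≤ φ z) ∧ (∀ z, φ z = 0 ↔ z ∈ C) ∧
      IsOpen V ∧ K ⊆ V ∧ V ⊆ O ∧ ∀ z, r z ∈ V → 1 ≤ φ z := by
  obtain ⟨f, hf, hf₀, hfC⟩ := hC.exists_continuous_eq_zero_iff
  obtain ⟨g, hg₀, hg₁, hg⟩ := exists_continuous_zero_one_of_isClosed hO.isClosed_compl hK
    (Set.disjoint_compl_left_iff_subset.2 hKO)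
  -- `f` controls the zero set; the Urysohn function `g`, equal to `1` on `K` and `0` off `O`, gives
  -- the lower bound and does not disturb the zeros on `C`.
  refine ⟨fun z => f z + 2 * g (r z), {e | 1 / 2 < g e}, by fun_prop,
    fun z => by linarith [hf₀ z, (hg (r z)).1], fun z => ⟨fun h => ?_, fun h => ?_⟩,
    isOpen_lt continuous_const g.continuous, fun e he => ?_, fun e he => ?_, fun z hz => ?_⟩
  · exact (hfC z).1 (by linarith [hf₀ z, (hg (r z)).1])
  · simp [(hfC z).2 h, hg₀ (hCO z h)]
  · rw [Set.mem_ofPred_eq, hg₁ he]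
    norm_num
  · by_contra hc
    rw [Set.mem_ofPred_eq, hg₀ hc] at he
    norm_num at he
  · rw [Set.mem_ofPred_eq] at hz
    linarith [hf₀ z]

namespace SkewProductSemiflow

variable {Y X : Type*} [MetricSpace Y] [MetricSpace X] (S : SkewProductSemiflow Y X)

/-- Regularisation of an index pair, for every notion of admissibility which implies admissibility
in the sense of Rybakowski. -/
theorem IsIndexPair.exists_isRegularIndexPair {Adm : Set (Y × X) → Prop}
    (hAdm : ∀ N, Adm N → AsymptoticallyStronglyAdmissible S.semiflow N) {y₀ : Y}
    {K : Set (Y × X)} {N₁ N₂ : Set (ℝ≥0 × X)} (h : S.IsIndexPair Adm y₀ K N₁ N₂) :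
    ∃ (τ : ℝ≥0) (N₂' : Set (ℝ≥0 × X)), N₂' ⊆ N₁ ∧ N₂ ⊆ N₂' ∧
      N₂' ⊆ backwardExtension (S.extendedSemiflow y₀) N₁ N₂ τ ∧
      S.IsRegularIndexPair Adm y₀ K N₁ N₂' := by
  have hπ := S.isSemiflow_semiflow
  have hχ := S.isSemiflow_extendedSemiflow y₀
  obtain ⟨N, hN, hNK, hDN⟩ := h.exists_isolating
  obtain ⟨W, ⟨hWA, hKA, hW⟩, hWD⟩ := h.exists_neighbourhood
  set A : Set (Y × X) := S.positiveHull y₀ ×ˢ Set.univ with hA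
  have hKc : IsClosed K := by
    rw [← hNK.largest_invariant]
    exact isClosed_invariantPart hπ hNK.isClosed (hAdm N hN)
  -- `W` is a neighbourhood only relative to `A`; adjoining `Aᶜ` makes it a genuine one and is
  -- harmless, as `r` takes values in `A`.
  have hOW : ∀ p, S.toHull y₀ p ∈ interior (W ∪ Aᶜ) → p ∈ N₁ \ N₂ := fun p hp =>
    hWD ((interior_subset hp).resolve_right fun hc => hc (S.toHull_mem y₀ p))
  have hKO : K ⊆ interior (W ∪ Aᶜ) := fun z hz => by
    rw [mem_interior_iff_mem_nhds]
    filter_upwards [mem_nhdsWithin_iff_eventually.1 (hW z hz)] with z' hz'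
    exact or_iff_not_imp_right.2 fun hc => hz' (not_not.1 hc)
  obtain ⟨φ, V, hφ, hφ_nonneg, hφ_zero, hVo, hKV, hVO, hφV⟩ :=
    exists_continuous_one_le h.basic.isClosed_right (S.continuous_toHull y₀) hKc isOpen_interior hKO
      fun z hz hzO => (hOW z hzO).2 hz
  have hφ₀ : ∀ z ∈ N₂, φ z = 0 := fun z hz => (hφ_zero z).2 hz
  have hφ₁ : ∀ z ∉ N₂, 0 < φ z := fun z hz =>
    (hφ_nonneg z).lt_of_ne fun hc => hz ((hφ_zero z).1 hc.symm)
  have hVD : S.toHull y₀ ⁻¹' V ⊆ N₁ \ N₂ := fun p hp => hOW p (hVO hp)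
  obtain ⟨T, hT⟩ := exists_middlePoints_subset hπ hNK.isClosed (hAdm N hN) hVo
    (hNK.largest_invariant.symm ▸ hKV)
  -- Each time in `[T, T + 1]` has at least `T` before and after it, so there the orbit projects to
  -- `middlePoints` and hence into `V`; this unit interval contributes at least `1`.
  have hB : ∀ x ∈ N₁, StaysOn (S.extendedSemiflow y₀) (N₁ \ N₂) x (T + 1 + T) →
      1 ≤ exitIntegral (S.extendedSemiflow y₀) (N₁ \ N₂) φ (T + 1 + T) x := by
    intro x hx hs
    refine h.basic.one_le_exitIntegral hχ hφ hφ₀ hφ_nonneg hx (a := T) le_self_add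
      fun s hTs hsT => ?_
    have hs' : StaysOn (S.extendedSemiflow y₀) (N₁ \ N₂) x (s + T) := hs.of_le (by gcongr)
    refine le_cutoff (hs'.of_le le_self_add) fun w _ e => hφV w (hT ?_)
    obtain ⟨q, rfl⟩ := exists_add_of_le hTs
    obtain ⟨v, -, ev⟩ := hs' q (by rw [add_comm T q, add_assoc]; exact le_self_add)
    refine ⟨S.toHull y₀ v, ?_, S.semiflow_toHull_of_eq (eq_some_of_add hχ ev (by rwa [add_comm]))⟩
    have : T + q + T = q + (T + T) := by ring
    rw [this] at hs'
    exact S.staysOn_toHull_iff.2 (((hχ.staysOn_add ev).1 hs').2.mono hDN)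
  have hN₂ := h.basic.subset_regularExitSet hχ (φ := φ) (B := T + 1 + T)
  refine ⟨T + 1 + T, regularExitSet (S.extendedSemiflow y₀) N₁ N₂ φ (T + 1 + T), fun _ hx => hx.1,
    hN₂, h.basic.regularExitSet_subset_backwardExtension hB,
    ⟨h.basic.isBasicIndexPair_regularExitSet hχ hφ hφ₀ hφ₁ hB, h.subset_omega, h.invariant,
      ⟨N, hN, hNK, (Set.sdiff_subset_sdiff_right hN₂).trans hDN⟩,
      -- Being in `V` bounds `φ` but not the integral. A unit of time spent in `V` makes the
      -- integral at least `1`, which keeps the point out of the new exit set; invariance of `K`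
      -- provides that unit of time on `K`.
      ⟨A ∩ {z | StaysOn S.semiflow V z 1}, ⟨Set.inter_subset_left, hKA, fun z hz => ?_⟩,
        fun x hx => ?_⟩⟩,
    h.basic.continuousOn_innerExitTime hχ hφ hφ₀ hφ₁ hB⟩
  · refine Filter.inter_mem self_mem_nhdsWithin (mem_nhdsWithin_of_mem_nhds ?_)
    refine ((hπ.isOpen_staysOn hVo).preimage
      (by fun_prop : Continuous fun z : Y × X => ((1 : ℝ≥0), z))).mem_nhds fun s _ => ?_
    obtain ⟨u, hu, huK, rfl⟩ : z ∈ invariantPart S.semiflow K := h.invariant.symm ▸ hz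
    exact ⟨u s, hKV (huK s), by simpa using hu 0 s s.coe_nonneg⟩
  · have hxV := S.staysOn_toHull_iff.1 hx.2
    have hxD := hxV.mono hVD
    have hxD₀ := (staysIn_iff_of_eq (hχ.map_zero x)).1 (hxD 0 zero_le)
    refine ⟨hxD₀.1, fun hc => ?_⟩
    have := h.basic.one_le_exitIntegral hχ hφ hφ₀ hφ_nonneg hxD₀.1 (a := 0) (B := T + 1 + T)
      (by rw [zero_add, add_right_comm]; exact le_add_self) fun s _ hs => by
        rw [zero_add] at hs
        refine le_cutoff (hxD.of_le hs) fun w _ e => hφV w ?_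
        exact (staysIn_iff_of_eq e).1 (hxV s hs)
    linarith [hc.2]

end SkewProductSemiflow

theorem mainTheorem5 {Y X : Type*} [MetricSpace Y] [MetricSpace X]
    (S : SkewProductSemiflow Y X) (y₀ : Y) (K : Set (Y × X)) (N₁ N₂ : Set (ℝ≥0 × X)) :
    (S.IsIndexPair (StronglyAdmissible S.semiflow) y₀ K N₁ N₂ →
      ∃ (τ : ℝ≥0) (N₂' : Set (ℝ≥0 × X)), N₂' ⊆ N₁ ∧ N₂ ⊆ N₂' ∧
        N₂' ⊆ backwardExtension (S.extendedSemiflow y₀) N₁ N₂ τ ∧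
        S.IsRegularIndexPair (StronglyAdmissible S.semiflow) y₀ K N₁ N₂') ∧
    (S.IsIndexPair (AsymptoticallyStronglyAdmissible S.semiflow) y₀ K N₁ N₂ →
      ∃ (τ : ℝ≥0) (N₂' : Set (ℝ≥0 × X)), N₂' ⊆ N₁ ∧ N₂ ⊆ N₂' ∧
        N₂' ⊆ backwardExtension (S.extendedSemiflow y₀) N₁ N₂ τ ∧
        S.IsRegularIndexPair (AsymptoticallyStronglyAdmissible S.semiflow) y₀ K N₁ N₂') :=
  ⟨fun h => h.exists_isRegularIndexPair S fun _ hN =>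
      hN.asymptoticallyStronglyAdmissible S.isSemiflow_semiflow,
    fun h => h.exists_isRegularIndexPair S fun _ hN => hN⟩
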